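/- Let $k$ be a field of characteristic zero and $m\in\mathbb N$. A rooted circle tree (rct) $c^i$ consists of a root with index $i\in\{1,\dots,m\}$ and a finite, possibly empty, linearly ordered list $V(c)$ of internal vertices (ordered clockwise, starting to the right of the root). In a \emph{bicolored} rct each internal vertex is black or white; in a \emph{decorated} rct each internal vertex carries a letter of $X=\{x_0,x_1,\dots,x_m\}$, and a vertex is called white if its letter is $x_0$ and black otherwise. Let $\mathcal H_f^\circ$ (resp. $\mathcal H_X^\circ$) be the commutative polynomial $k$-algebra freely generated by all bicolored (resp. decorated) rcts, graded by letting $$\deg(c^i)=2\cdot\#\{\text{white vertices}\}+\#\{\text{black internal vertices}\}+1$$ and letting the degree of a monomial be the sum of the degrees of its factors. A subset $J\subseteq V(c)$ is \emph{admissible} if it is non-empty and its minimal element is white. An \emph{admissible extraction} of $c^i$ is either a (possibly empty) set $\mathcal J=\{J_1,\dots,J_s\}$ of pairwise disjoint admissible subsets, or the extraction of the whole of $c^i$, root included. For $\mathcal J=\{J_1,\dots,J_s\}$ and indices $n_1,\dots,n_s\in\{1,\dots,m\}$, let $c^i_{n_1\cdots n_s}$ be the rct with root index $i$ obtained from $c^i$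 by turning, for each $l$, the minimal element of $J_l$ into a black vertex (carrying the letter $x_{n_l}$ in the decorated case) and deleting the other elements of $J_l$; and let $c^{n_l}_{|J_l}$ be the rct whose root, with index $n_l$, is the minimal element of $J_l$ and whose internal vertices are the remaining elements of $J_l$, in their order and with their colors (letters). Let $\Delta$ be the unital algebra homomorphism into the tensor square given on rcts by $$\Delta(c^i)=\mathbf 1\otimes c^i+\sum_{\mathcal J=\{J_1,\dots,J_s\}}\ \sum_{n_1,\dots,n_s=1}^m c^i_{n_1\cdots n_s}\otimes c^{n_1}_{|J_1}\cdots c^{n_s}_{|J_s},$$ where $\mathcal J$ runs over all sets of pairwise disjoint admissible subsets (the empty one contributes $c^i\otimes\mathbf 1$, and the extraction of the whole of $c^i$ contributes $\mathbf 1\otimes c^i$), and let the counit be the algebra homomorphism to $k$ that sends every rct to $0$. Then $\mathcal H_f^\circ$, with this product, coproduct, counit and grading, is a connected graded commutative unital Hopf algebra: $\Delta$ is coassociative and counital, an antipode exists, the product and the coproduct respect the grading, and the component of degree $0$ is $k\mathbf 1$. The same holds for $\mathcal H_X^\circ$. -/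

import Mathlib

open scoped TensorProduct

/-- The colour of an internal vertex of a rooted circle tree: white, or black. A black vertex
carries a label in `β`: `β = Unit` records the colour only, and `β = Fin m` records which of the
letters `x_1, …, x_m` decorates the vertex (a white vertex is one decorated by `x_0`). -/
inductive CircleVertex (β : Type) where
  | white : CircleVertex β
  | black (b : β) : CircleVertex β

/-- A rooted circle tree: the index of its root, and its internal vertices listed in their
clockwise order, starting to the right of the root. `Fin m` stands for `{1, …, m}`. -/
@[ext]
structure CircleTree (m : ℕ) (β : Type) where
  root : Fin m
  inner : List (CircleVertex β)

/-- Rooted circle trees whose internal vertices are coloured black or white. -/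
abbrev BicoloredCircleTree (m : ℕ) : Type := CircleTree m Unit

/-- Rooted circle trees whose internal vertices are decorated by `x_0, x_1, …, x_m`. -/
abbrev DecoratedCircleTree (m : ℕ) : Type := CircleTree m (Fin m)

namespace CircleTree

variable {m : ℕ} {β : Type}

/-- Internal vertices of `c`, in their natural order. -/
abbrev Pos (c : CircleTree m β) : Type := Fin c.inner.length

/-- The colour (and label) of an internal vertex. -/
def colour (c : CircleTree m β) (p : c.Pos) : CircleVertex β := c.inner.get p

/-- `2 · (number of white vertices) + (number of black internal vertices) + 1`. -/
def deg (c : CircleTree m β) : ℕ :=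
  2 * c.inner.countP (fun v => match v with | .white => true | .black _ => false) +
    c.inner.countP (fun v => match v with | .white => false | .black _ => true) + 1

/-- A set of internal vertices is admissible if it has a minimal element, which is white. -/
def IsAdmissible (c : CircleTree m β) (J : Finset c.Pos) : Prop :=
  ∃ p, IsLeast (J : Set c.Pos) p ∧ c.colour p = .white

open Classical in
/-- The sets of pairwise disjoint admissible sets of internal vertices, the empty one included.
(The extraction of the whole tree, root included, is treated apart in `comulTree`.) -/
noncomputable def extractions (c : CircleTree m β) : Finset (Finset (Finset c.Pos)) :=
  Finset.univ.filter fun 𝒥 =>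
    (∀ J ∈ 𝒥, c.IsAdmissible J) ∧ ∀ J ∈ 𝒥, ∀ K ∈ 𝒥, J ≠ K → Disjoint J K

/-- The sub-tree carried by `J`: the minimal element of `J` becomes the root, with index `n`, and
the other elements of `J` are the internal vertices. -/
def sub (c : CircleTree m β) (J : Finset c.Pos) (n : Fin m) : CircleTree m β where
  root := n
  inner := (J.sort (· ≤ ·)).tail.map c.colour

open Classical in
/-- The quotient of `c` by the extraction `𝒥`: in each `J ∈ 𝒥` the minimal element becomes a black
vertex with index `n J`, entered as the label `label (n J)`, and the other elements of `J` are
eliminated. -/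
noncomputable def quot (label : Fin m → β) (c : CircleTree m β) (𝒥 : Finset (Finset c.Pos))
    (n : 𝒥 → Fin m) : CircleTree m β where
  root := c.root
  inner := ((Finset.univ.filter fun p : c.Pos =>
      ∀ J ∈ 𝒥, p ∈ J → IsLeast (J : Set c.Pos) p).sort (· ≤ ·)).map fun p =>
    if h : ∃ J : 𝒥, IsLeast (J.1 : Set c.Pos) p then .black (label (n h.choose)) else c.colour p

variable (k : Type*) [Field k]

/-- The coproduct of a single tree. The first term is the extraction of the whole tree. In the other
terms the new root indices `n J`, one for each `J ∈ 𝒥`, are summed over all their values. -/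
noncomputable def comulTree (label : Fin m → β) (c : CircleTree m β) :
    MvPolynomial (CircleTree m β) k ⊗[k] MvPolynomial (CircleTree m β) k :=
  1 ⊗ₜ[k] MvPolynomial.X c +
    ∑ 𝒥 ∈ c.extractions, ∑ n : 𝒥 → Fin m,
      MvPolynomial.X (c.quot label 𝒥 n) ⊗ₜ[k] ∏ J : 𝒥, MvPolynomial.X (c.sub J.1 (n J))

/-- The multiplicative extension of the coproduct to the polynomial algebra on all trees. -/
noncomputable def comul (label : Fin m → β) :
    MvPolynomial (CircleTree m β) k →ₐ[k]
      MvPolynomial (CircleTree m β) k ⊗[k] MvPolynomial (CircleTree m β) k :=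
  MvPolynomial.aeval (comulTree k label)

/-- The counit: the algebra map that sends every tree to `0`. -/
noncomputable def counit (m : ℕ) (β : Type) : MvPolynomial (CircleTree m β) k →ₐ[k] k :=
  MvPolynomial.aeval fun _ => 0

/-- The homogeneous component of degree `d`: spanned by the monomials in trees whose degrees add up
to `d`. -/
noncomputable def component (m : ℕ) (β : Type) (d : ℕ) :
    Submodule k (MvPolynomial (CircleTree m β) k) :=
  MvPolynomial.weightedHomogeneousSubmodule k (deg : CircleTree m β → ℕ) d

end CircleTree

/-- The (commutative, unital) `k`-algebra `A` is a connected graded Hopf algebra with the coproduct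
`Δ`, the counit `ε` and the homogeneous components `𝒜 d`, `d ≥ 0`. -/
structure IsConnectedGradedHopfAlgebra {k A : Type*} [Field k] [CommRing A] [Algebra k A]
    (Δ : A →ₐ[k] A ⊗[k] A) (ε : A →ₐ[k] k) (𝒜 : ℕ → Submodule k A) : Prop where
  /-- `(Δ, ε)` is a coassociative counital bialgebra structure on the algebra `A`, and it has an
  antipode. -/
  hopf : ∃ (h_coassoc : (Algebra.TensorProduct.assoc k k k A A A).toAlgHom.comp
        ((Algebra.TensorProduct.map Δ (.id k A)).comp Δ) =
          (Algebra.TensorProduct.map (.id k A) Δ).comp Δ)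
      (h_rTensor : (Algebra.TensorProduct.map ε (.id k A)).comp Δ =
        (Algebra.TensorProduct.lid k A).symm)
      (h_lTensor : (Algebra.TensorProduct.map (.id k A) ε).comp Δ =
        (Algebra.TensorProduct.rid k k A).symm)
      (H : HopfAlgebra k A),
      H.toBialgebra = Bialgebra.ofAlgHom Δ ε h_coassoc h_rTensor h_lTensor
  /-- `A` is the direct sum of the `𝒜 d`, with `1 ∈ 𝒜 0` and `𝒜 p * 𝒜 q ⊆ 𝒜 (p + q)`. -/
  graded : Nonempty (GradedAlgebra 𝒜)
  /-- `Δ (𝒜 d)` lies in the sum of the `𝒜 p ⊗ 𝒜 q` with `p + q = d`. -/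
  comul_mem : ∀ d, ∀ x ∈ 𝒜 d, Δ x ∈ ⨆ (p : ℕ) (q : ℕ) (_ : p + q = d),
    LinearMap.range (TensorProduct.mapIncl (𝒜 p) (𝒜 q))
  /-- Connectedness. -/
  connected : 𝒜 0 = Submodule.span k {1}

/-!
# The Hopf algebras of rooted circle trees

Let `H` be the polynomial algebra on the trees, and for a vertex `v` let `append k v` be the
derivation of `H` which sends a tree `c` to `c.snoc v`, the tree with `v` appended as last vertex.
Every tree arises from a tree without internal vertices by appending vertices, so everything can be
proved by induction on the last vertex once it is known how the coproduct `Δ` meets these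
derivations. This is `comulTree_snoc`: with `D v` for `append k v`,

* `Δ ∘ D b = (D b ⊗ 1 + 1 ⊗ D b) ∘ Δ` for a black vertex `b`,
* `Δ ∘ D w = (D w ⊗ 1 + 1 ⊗ D w + ∑ j, D (b j) ⊗ X j) ∘ Δ` for the white vertex `w`,

where `b j` is the black vertex carrying the label of `j`, and `X j` is the tree with root index `j`
and no internal vertex, or multiplication by it. Indeed, in an extraction the last vertex is either
left alone, or joins one of the extracted sets (`1 ⊗ D v` runs over these by the Leibniz rule), or,
if it is white, makes up an extracted set of its own. The bijection behind this is
`sum_labelledExtractions_succ`; for it, an extraction together with its root indices is encoded as a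
finite set of pairs (set of positions, root index), with positions in `ℕ` so that the extractions
from `N` and from `N + 1` vertices live in the same type.

The operators on the right are derivations of `H ⊗ H`, so the two identities hold on all of `H` as
soon as they hold on trees. Both iterated coproducts intertwine `D v` with one and the same
derivation of `H ⊗ H ⊗ H`, and they agree on the trees without internal vertices, which are
primitive: this is coassociativity. The counit kills the image of each `D v`, which gives
counitality. The antipode `S` is the algebra map with `S (X j) = -X j`, `S ∘ D b = D b ∘ S` and
`S ∘ D w = (D w - ∑ j, X j * D (b j)) ∘ S`, and the antipode axioms follow by the same induction.
Finally `D v` raises the degree by `2` if `v` is white and by `1` if it is black, and so does the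
operator on the right, which makes `Δ` graded. Nothing depends on how the indices `j` are turned
into labels, so the bicolored and the decorated trees are treated together.
-/

/-! ### Derivations -/

namespace Derivation

variable {k A B : Type*} [CommRing k] [CommRing A] [CommRing B] [Algebra k A] [Algebra k B]

/-- The derivation `D ⊗ id` of `A ⊗ B`. -/
noncomputable def tensorRight (B : Type*) [CommRing B] [Algebra k B] (D : Derivation k A A) :
    Derivation k (A ⊗[k] B) (A ⊗[k] B) :=
  Derivation.mk' ((D : A →ₗ[k] A).rTensor B) fun x y => by
    induction x with
    | zero => simp
    | add x₁ x₂ h₁ h₂ => simp only [add_mul, map_add, h₁, h₂, add_smul, smul_add]; abel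
    | tmul a b =>
      induction y with
      | zero => simp
      | add y₁ y₂ h₁ h₂ => simp only [mul_add, map_add, h₁, h₂, add_smul, smul_add]; abel
      | tmul a' b' =>
        simp [TensorProduct.add_tmul, mul_comm b' b]

@[simp] lemma tensorRight_tmul (D : Derivation k A A) (a : A) (b : B) :
    D.tensorRight B (a ⊗ₜ b) = D a ⊗ₜ b := rfl

/-- The derivation `id ⊗ D` of `A ⊗ B`. -/
noncomputable def tensorLeft (A : Type*) [CommRing A] [Algebra k A] (D : Derivation k B B) :
    Derivation k (A ⊗[k] B) (A ⊗[k] B) :=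
  Derivation.mk' ((D : B →ₗ[k] B).lTensor A) fun x y => by
    induction x with
    | zero => simp
    | add x₁ x₂ h₁ h₂ => simp only [add_mul, map_add, h₁, h₂, add_smul, smul_add]; abel
    | tmul a b =>
      induction y with
      | zero => simp
      | add y₁ y₂ h₁ h₂ => simp only [mul_add, map_add, h₁, h₂, add_smul, smul_add]; abel
      | tmul a' b' =>
        simp [TensorProduct.tmul_add, mul_comm a' a]

@[simp] lemma tensorLeft_tmul (D : Derivation k B B) (a : A) (b : B) :
    D.tensorLeft A (a ⊗ₜ b) = a ⊗ₜ D b := rfl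

lemma sum_apply {ι : Type*} (s : Finset ι) (D : ι → Derivation k A A) (a : A) :
    (∑ i ∈ s, D i) a = ∑ i ∈ s, D i a := by
  rw [← Derivation.coeFnAddMonoidHom_apply, map_sum, Finset.sum_apply]
  rfl

/-- The Leibniz rule for a product over a finite set. -/
lemma leibniz_finsetProd {ι : Type*} [DecidableEq ι] (D : Derivation k A A) (s : Finset ι)
    (g : ι → A) : D (∏ i ∈ s, g i) = ∑ i ∈ s, (∏ l ∈ s.erase i, g l) * D (g i) := by
  induction s using Finset.induction_on with
  | empty => simp
  | insert i s hi ih =>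
    rw [Finset.prod_insert hi, D.leibniz, Finset.sum_insert hi, Finset.erase_insert hi, ih,
      add_comm, smul_eq_mul, smul_eq_mul, Finset.mul_sum]
    congr 1
    refine Finset.sum_congr rfl fun l hl => ?_
    rw [Finset.erase_insert_of_ne (ne_of_mem_of_not_mem hl hi).symm,
      Finset.prod_insert fun h => hi (Finset.mem_of_mem_erase h), mul_assoc]

end Derivation

namespace MvPolynomial

/-- An algebra map intertwines two derivations as soon as it does so on the generators. -/
lemma algHom_derivation_apply {k σ B : Type*} [CommRing k] [CommRing B] [Algebra k B]
    (φ : MvPolynomial σ k →ₐ[k] B) (D : Derivation k (MvPolynomial σ k) (MvPolynomial σ k))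
    (T : Derivation k B B) (h : ∀ s, φ (D (X s)) = T (φ (X s))) (x : MvPolynomial σ k) :
    φ (D x) = T (φ x) := by
  induction x using MvPolynomial.induction_on with
  | C a => simp [← MvPolynomial.algebraMap_eq]
  | add p q hp hq => simp [hp, hq]
  | mul_X p s hp => simp [hp, h]

end MvPolynomial

/-! ### Hopf algebras from algebra maps -/

/-- A commutative bialgebra with an algebra map satisfying the antipode axioms is a Hopf algebra. -/
lemma exists_hopfAlgebra_eq_ofAlgHom {k A : Type*} [Field k] [CommRing A] [Algebra k A]
    {Δ : A →ₐ[k] A ⊗[k] A} {ε : A →ₐ[k] k}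
    (h_coassoc : (Algebra.TensorProduct.assoc k k k A A A).toAlgHom.comp
      ((Algebra.TensorProduct.map Δ (.id k A)).comp Δ) =
        (Algebra.TensorProduct.map (.id k A) Δ).comp Δ)
    (h_rTensor : (Algebra.TensorProduct.map ε (.id k A)).comp Δ =
      (Algebra.TensorProduct.lid k A).symm)
    (h_lTensor : (Algebra.TensorProduct.map (.id k A) ε).comp Δ =
      (Algebra.TensorProduct.rid k k A).symm)
    (S : A →ₐ[k] A)
    (h_left : (Algebra.TensorProduct.lift S (.id k A) fun _ _ => .all _ _).comp Δ =
      (Algebra.ofId k A).comp ε)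
    (h_right : (Algebra.TensorProduct.lift (.id k A) S fun _ _ => .all _ _).comp Δ =
      (Algebra.ofId k A).comp ε) :
    ∃ (h_coassoc : (Algebra.TensorProduct.assoc k k k A A A).toAlgHom.comp
        ((Algebra.TensorProduct.map Δ (.id k A)).comp Δ) =
          (Algebra.TensorProduct.map (.id k A) Δ).comp Δ)
      (h_rTensor : (Algebra.TensorProduct.map ε (.id k A)).comp Δ =
        (Algebra.TensorProduct.lid k A).symm)
      (h_lTensor : (Algebra.TensorProduct.map (.id k A) ε).comp Δ =
        (Algebra.TensorProduct.rid k k A).symm)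
      (𝓗 : HopfAlgebra k A),
      𝓗.toBialgebra = Bialgebra.ofAlgHom Δ ε h_coassoc h_rTensor h_lTensor := by
  refine ⟨h_coassoc, h_rTensor, h_lTensor,
    { toBialgebra := Bialgebra.ofAlgHom Δ ε h_coassoc h_rTensor h_lTensor
      antipode := S.toLinearMap
      mul_antipode_rTensor_comul := ?_
      mul_antipode_lTensor_comul := ?_ }, rfl⟩
  · have h : LinearMap.mul' k A ∘ₗ S.toLinearMap.rTensor A =
        (Algebra.TensorProduct.lift S (.id k A) fun _ _ => .all _ _).toLinearMap := by
      ext; simp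
    exact (LinearMap.comp_assoc _ _ _).symm.trans
      ((congrArg (· ∘ₗ Δ.toLinearMap) h).trans (congrArg AlgHom.toLinearMap h_left))
  · have h : LinearMap.mul' k A ∘ₗ S.toLinearMap.lTensor A =
        (Algebra.TensorProduct.lift (.id k A) S fun _ _ => .all _ _).toLinearMap := by
      ext; simp
    exact (LinearMap.comp_assoc _ _ _).symm.trans
      ((congrArg (· ∘ₗ Δ.toLinearMap) h).trans (congrArg AlgHom.toLinearMap h_right))

/-! ### Appending a vertex -/

namespace CircleTree

open MvPolynomial (X)

variable {m : ℕ} {β : Type}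

/-- The tree `c` with one more internal vertex `v`, placed after all the others. -/
def snoc (c : CircleTree m β) (v : CircleVertex β) : CircleTree m β := ⟨c.root, c.inner ++ [v]⟩

/-- The tree with root index `i` and no internal vertex. -/
abbrev bare (β : Type) {m : ℕ} (i : Fin m) : CircleTree m β := ⟨i, []⟩

@[elab_as_elim]
lemma snoc_induction {motive : CircleTree m β → Prop} (bare : ∀ i, motive (bare β i))
    (snoc : ∀ c v, motive c → motive (c.snoc v)) (c : CircleTree m β) : motive c := by
  obtain ⟨i, l⟩ := c
  induction l using List.reverseRecOn with
  | nil => exact bare i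
  | append_singleton l v ih => exact snoc ⟨i, l⟩ v ih

variable (k : Type*) [Field k]

/-- The polynomial algebra on the trees. -/
local notation "H" => MvPolynomial (CircleTree m β) k

/-- The derivation of the algebra of trees which appends the vertex `v` to a tree. -/
noncomputable def append (v : CircleVertex β) : Derivation k H H :=
  MvPolynomial.mkDerivation k fun c => X (c.snoc v)

@[simp] lemma append_X (v : CircleVertex β) (c : CircleTree m β) :
    append k v (X c : H) = X (c.snoc v) :=
  MvPolynomial.mkDerivation_X k _ c

/-- The derivation of `H ⊗ B` which appends the vertex `v` to the left factor, or acts by `E v` on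
the right factor, or, if `v` is white, appends a black vertex with index `j` to the left factor and
multiplies the right factor by `x j`. -/
noncomputable def appendTensor {B : Type*} [CommRing B] [Algebra k B] (label : Fin m → β)
    (E : CircleVertex β → Derivation k B B) (x : Fin m → B) :
    CircleVertex β → Derivation k (H ⊗[k] B) (H ⊗[k] B)
  | .white => (append k .white).tensorRight B + (E .white).tensorLeft H +
      ∑ j, ((1 : H) ⊗ₜ[k] x j) • (append k (.black (label j))).tensorRight B
  | .black b => (append k (.black b)).tensorRight B + (E (.black b)).tensorLeft H

/-- The derivation of the tensor square through which the coproduct sees `append k v`: the new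
vertex is appended on the left or on the right, or, if it is white, it starts a new extracted tree
with root index `j` and leaves a black vertex behind. -/
noncomputable def coappend (label : Fin m → β) :
    CircleVertex β → Derivation k (H ⊗[k] H) (H ⊗[k] H) :=
  appendTensor k label (append k) fun j => X (bare β j)

variable {k}

lemma appendTensor_white_tmul {B : Type*} [CommRing B] [Algebra k B] (label : Fin m → β)
    (E : CircleVertex β → Derivation k B B) (x : Fin m → B) (a : H) (b : B) :
    appendTensor k label E x .white (a ⊗ₜ b) = append k .white a ⊗ₜ b + a ⊗ₜ E .white b +
      ∑ j, append k (.black (label j)) a ⊗ₜ (x j * b) := by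
  simp [appendTensor, Derivation.sum_apply]

lemma appendTensor_black_tmul {B : Type*} [CommRing B] [Algebra k B] (label : Fin m → β)
    (E : CircleVertex β → Derivation k B B) (x : Fin m → B) (c : β) (a : H) (b : B) :
    appendTensor k label E x (.black c) (a ⊗ₜ b) =
      append k (.black c) a ⊗ₜ b + a ⊗ₜ E (.black c) b := by
  simp [appendTensor]

lemma coappend_white_tmul (label : Fin m → β) (a b : H) :
    coappend k label .white (a ⊗ₜ b) = append k .white a ⊗ₜ b + a ⊗ₜ append k .white b +
      ∑ j, append k (.black (label j)) a ⊗ₜ (X (bare β j) * b) :=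
  appendTensor_white_tmul _ _ _ _ _

lemma coappend_black_tmul (label : Fin m → β) (c : β) (a b : H) :
    coappend k label (.black c) (a ⊗ₜ b) =
      append k (.black c) a ⊗ₜ b + a ⊗ₜ append k (.black c) b :=
  appendTensor_black_tmul _ _ _ _ _ _

/-! ### Labelled extractions -/

/-- A set `J` of positions has a least element, at which the colouring `f` is white. -/
def IsWhiteLed (f : ℕ → CircleVertex β) (J : Finset ℕ) : Prop :=
  ∃ p, IsLeast (J : Set ℕ) p ∧ f p = .white

lemma IsWhiteLed.nonempty {f : ℕ → CircleVertex β} {J : Finset ℕ} (h : IsWhiteLed f J) :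
    J.Nonempty := by
  obtain ⟨p, hp, -⟩ := h
  exact ⟨p, hp.1⟩

open Classical in
/-- The extractions from the first `N` vertices of the colouring `f`, each extracted set coming with
the root index assigned to it. -/
noncomputable def labelledExtractions (m : ℕ) (f : ℕ → CircleVertex β) (N : ℕ) :
    Finset (Finset (Finset ℕ × Fin m)) :=
  ((Finset.range N).powerset ×ˢ Finset.univ).powerset.filter fun 𝒬 =>
    (∀ P ∈ 𝒬, IsWhiteLed f P.1) ∧ ∀ P ∈ 𝒬, ∀ Q ∈ 𝒬, P ≠ Q → Disjoint P.1 Q.1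

lemma mem_labelledExtractions {f : ℕ → CircleVertex β} {N : ℕ}
    {𝒬 : Finset (Finset ℕ × Fin m)} :
    𝒬 ∈ labelledExtractions m f N ↔ (∀ P ∈ 𝒬, ∀ p ∈ P.1, p < N) ∧ (∀ P ∈ 𝒬, IsWhiteLed f P.1) ∧
      ∀ P ∈ 𝒬, ∀ Q ∈ 𝒬, ∀ p ∈ P.1, p ∈ Q.1 → P = Q := by
  simp only [labelledExtractions, Finset.mem_filter, Finset.mem_powerset, Finset.subset_iff,
    Finset.mem_product, Finset.mem_univ, and_true, Finset.mem_range]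
  refine and_congr Iff.rfl (and_congr Iff.rfl ?_)
  refine forall₄_congr fun P _ Q _ => ?_
  rw [← not_imp_not, not_not, Finset.not_disjoint_iff]
  exact ⟨fun h p hp hq => h ⟨p, hp, hq⟩, fun h ⟨p, hp, hq⟩ => h p hp hq⟩

open Classical in
/-- What the extraction `𝒬` leaves at the position `p`: nothing if `p` is a non-minimal element of
an extracted set, a black vertex if it is a minimal one, the original vertex otherwise. -/
noncomputable def residue (label : Fin m → β) (f : ℕ → CircleVertex β)
    (𝒬 : Finset (Finset ℕ × Fin m)) (p : ℕ) : Option (CircleVertex β) :=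
  if ∀ P ∈ 𝒬, p ∈ P.1 → IsLeast (P.1 : Set ℕ) p then
    if h : ∃ P ∈ 𝒬, IsLeast (P.1 : Set ℕ) p then some (.black (label h.choose.2)) else some (f p)
  else none

section residue

variable {label : Fin m → β} {f : ℕ → CircleVertex β} {𝒬 : Finset (Finset ℕ × Fin m)} {p : ℕ}

lemma residue_of_forall_notMem (h : ∀ P ∈ 𝒬, p ∉ P.1) : residue label f 𝒬 p = some (f p) := by
  rw [residue, if_pos fun P hP hp => absurd hp (h P hP), dif_neg]
  rintro ⟨P, hP, hp⟩
  exact h P hP hp.1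

lemma residue_of_not_isLeast {P : Finset ℕ × Fin m} (hP : P ∈ 𝒬) (hp : p ∈ P.1)
    (h : ¬IsLeast (P.1 : Set ℕ) p) : residue label f 𝒬 p = none :=
  if_neg fun hl => h (hl P hP hp)

lemma residue_of_isLeast (hd : ∀ P ∈ 𝒬, ∀ Q ∈ 𝒬, ∀ p ∈ P.1, p ∈ Q.1 → P = Q)
    {P : Finset ℕ × Fin m} (hP : P ∈ 𝒬) (h : IsLeast (P.1 : Set ℕ) p) :
    residue label f 𝒬 p = some (.black (label P.2)) := by
  have hex : ∃ P ∈ 𝒬, IsLeast (P.1 : Set ℕ) p := ⟨P, hP, h⟩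
  have hc : hex.choose = P := hd _ hex.choose_spec.1 _ hP p hex.choose_spec.2.1 h.1
  rw [residue, if_pos, dif_pos hex, hc]
  intro Q hQ hp
  rwa [← hd P hP Q hQ p h.1 hp]

end residue

/-- The word of what the extraction `𝒬` leaves of the first `N` vertices. -/
noncomputable def residualWord (label : Fin m → β) (f : ℕ → CircleVertex β) (N : ℕ)
    (𝒬 : Finset (Finset ℕ × Fin m)) : List (CircleVertex β) :=
  (List.range N).filterMap (residue label f 𝒬)

/-- The tree extracted by the set `P.1` with root index `P.2`. -/
def extractedTree (f : ℕ → CircleVertex β) (P : Finset ℕ × Fin m) : CircleTree m β :=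
  ⟨P.2, (P.1.sort (· ≤ ·)).tail.map f⟩

variable (k) in
/-- The term of the coproduct which belongs to the labelled extraction `𝒬`. -/
noncomputable def extractionTerm (label : Fin m → β) (f : ℕ → CircleVertex β) (N : ℕ) (i : Fin m)
    (𝒬 : Finset (Finset ℕ × Fin m)) : H ⊗[k] H :=
  X ⟨i, residualWord label f N 𝒬⟩ ⊗ₜ ∏ P ∈ 𝒬, X (extractedTree f P)

/-! ### The coproduct as a sum over labelled extractions -/

lemma sort_map_eq_filterMap {N : ℕ} {γ : Type*} (S : Finset (Fin N)) (g : Fin N → γ) :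
    (S.sort (· ≤ ·)).map g =
      (List.finRange N).filterMap fun p => if p ∈ S then some (g p) else none := by
  have h : S.sort (· ≤ ·) = (List.finRange N).filter (· ∈ S) := by
    refine List.Perm.eq_of_pairwise' (Finset.pairwise_sort _ _)
      ((List.sortedLT_finRange N).sortedLE.pairwise.filter _) ?_
    rw [List.perm_ext_iff_of_nodup (Finset.sort_nodup _ _) ((List.nodup_finRange N).filter _)]
    simp
  rw [h, ← List.filterMap_eq_map, List.filterMap_filter]
  simp

lemma isLeast_map_val {N : ℕ} {J : Finset (Fin N)} {p : Fin N} :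
    IsLeast ((J.map Fin.valEmbedding : Finset ℕ) : Set ℕ) p ↔ IsLeast (J : Set (Fin N)) p := by
  simp [IsLeast, lowerBounds, Fin.val_inj]

open Classical in
/-- The extraction `𝒥` with the root indices `n`, in terms of positions. -/
noncomputable def labelled {N : ℕ} (𝒥 : Finset (Finset (Fin N))) (n : 𝒥 → Fin m) :
    Finset (Finset ℕ × Fin m) :=
  Finset.univ.image fun J : 𝒥 => (J.1.map Fin.valEmbedding, n J)

lemma mem_labelled {N : ℕ} {𝒥 : Finset (Finset (Fin N))} {n : 𝒥 → Fin m}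
    {P : Finset ℕ × Fin m} :
    P ∈ labelled 𝒥 n ↔ ∃ J : 𝒥, (J.1.map Fin.valEmbedding, n J) = P := by
  simp [labelled]

lemma mk_mem_labelled {N : ℕ} {𝒥 : Finset (Finset (Fin N))} {n : 𝒥 → Fin m}
    {J : Finset (Fin N)} {j : Fin m} :
    (J.map Fin.valEmbedding, j) ∈ labelled 𝒥 n ↔ ∃ h : J ∈ 𝒥, n ⟨J, h⟩ = j := by
  rw [mem_labelled]
  constructor
  · rintro ⟨⟨K, hK⟩, h⟩
    obtain ⟨h₁, h₂⟩ := Prod.mk.inj h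
    obtain rfl : K = J := Finset.map_injective _ h₁
    exact ⟨hK, h₂⟩
  · rintro ⟨h, rfl⟩
    exact ⟨⟨J, h⟩, rfl⟩

lemma mem_extractions {c : CircleTree m β} {𝒥 : Finset (Finset c.Pos)} :
    𝒥 ∈ c.extractions ↔ (∀ J ∈ 𝒥, c.IsAdmissible J) ∧
      ∀ J ∈ 𝒥, ∀ K ∈ 𝒥, J ≠ K → Disjoint J K := by
  simp [extractions]

section transfer

variable {c : CircleTree m β} {f : ℕ → CircleVertex β}

lemma isWhiteLed_map_val (hf : ∀ p : c.Pos, f p = c.colour p) {J : Finset c.Pos} :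
    IsWhiteLed f (J.map Fin.valEmbedding) ↔ c.IsAdmissible J := by
  constructor
  · rintro ⟨p, hp, hw⟩
    obtain ⟨q, hq, rfl⟩ := Finset.mem_map.1 (Finset.mem_coe.1 hp.1)
    exact ⟨q, isLeast_map_val.1 hp, by rw [← hf]; exact hw⟩
  · rintro ⟨p, hp, hw⟩
    exact ⟨p, isLeast_map_val.2 hp, by rw [hf, hw]⟩

lemma labelled_mem (hf : ∀ p : c.Pos, f p = c.colour p) {𝒥 : Finset (Finset c.Pos)}
    (h𝒥 : 𝒥 ∈ c.extractions) (n : 𝒥 → Fin m) :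
    labelled 𝒥 n ∈ labelledExtractions m f c.inner.length := by
  obtain ⟨hadm, hdis⟩ := mem_extractions.1 h𝒥
  simp only [mem_labelledExtractions, mem_labelled]
  refine ⟨?_, ?_, ?_⟩
  · rintro _ ⟨J, rfl⟩ p hp
    obtain ⟨q, -, rfl⟩ := Finset.mem_map.1 hp
    exact q.2
  · rintro _ ⟨J, rfl⟩
    exact (isWhiteLed_map_val hf).2 (hadm J.1 J.2)
  · rintro _ ⟨J, rfl⟩ _ ⟨K, rfl⟩ p hp hp'
    obtain ⟨q, hq, rfl⟩ := Finset.mem_map.1 hp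
    obtain ⟨q', hq', h⟩ := Finset.mem_map.1 hp'
    obtain rfl : q' = q := Fin.ext h
    by_cases hJK : J = K
    · rw [hJK]
    · exact absurd hq' (Finset.disjoint_left.1
        (hdis J.1 J.2 K.1 K.2 fun h => hJK (Subtype.ext h)) hq)

lemma exists_labelled_eq (hf : ∀ p : c.Pos, f p = c.colour p) {𝒬 : Finset (Finset ℕ × Fin m)}
    (h𝒬 : 𝒬 ∈ labelledExtractions m f c.inner.length) :
    ∃ 𝒥 ∈ c.extractions, ∃ n : 𝒥 → Fin m, labelled 𝒥 n = 𝒬 := by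
  classical
  obtain ⟨hlt, hadm, hdis⟩ := mem_labelledExtractions.1 h𝒬
  have hlift : ∀ P ∈ 𝒬, ∃ J : Finset c.Pos, J.map Fin.valEmbedding = P.1 := by
    intro P hP
    refine ⟨P.1.attachFin fun p hp => hlt P hP p hp, ?_⟩
    ext p
    simp only [Finset.mem_map, Finset.mem_attachFin, Fin.valEmbedding_apply]
    exact ⟨by rintro ⟨q, hq, rfl⟩; exact hq, fun hp => ⟨⟨p, hlt P hP p hp⟩, hp, rfl⟩⟩
  let 𝒥 : Finset (Finset c.Pos) :=
    Finset.univ.filter fun J => ∃ j, (J.map Fin.valEmbedding, j) ∈ 𝒬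
  have h𝒥 (J : 𝒥) : ∃ j, (J.1.map Fin.valEmbedding, j) ∈ 𝒬 := (Finset.mem_filter.1 J.2).2
  choose n hn using h𝒥
  refine ⟨𝒥, ?_, n, ?_⟩
  · refine mem_extractions.2 ⟨fun J hJ => ?_, fun J hJ K hK hne => ?_⟩
    · exact (isWhiteLed_map_val hf).1 (hadm _ (hn ⟨J, hJ⟩))
    · refine Finset.disjoint_left.2 fun p hp hp' => hne ?_
      have := hdis _ (hn ⟨J, hJ⟩) _ (hn ⟨K, hK⟩) p (Finset.mem_map_of_mem _ hp)
        (Finset.mem_map_of_mem _ hp')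
      exact Finset.map_injective _ (Prod.mk.inj this).1
  · ext P
    rw [mem_labelled]
    constructor
    · rintro ⟨J, rfl⟩
      exact hn J
    · intro hP
      obtain ⟨J, hJ⟩ := hlift P hP
      have hJ𝒥 : J ∈ 𝒥 := Finset.mem_filter.2 ⟨Finset.mem_univ _, P.2, by rw [hJ]; exact hP⟩
      refine ⟨⟨J, hJ𝒥⟩, ?_⟩
      obtain ⟨p, hp⟩ := (hadm P hP).nonempty
      exact hdis _ (hn ⟨J, hJ𝒥⟩) P hP p (by rw [hJ]; exact hp) hp

lemma residualWord_labelled (hf : ∀ p : c.Pos, f p = c.colour p) (label : Fin m → β)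
    {𝒥 : Finset (Finset c.Pos)} (h𝒥 : 𝒥 ∈ c.extractions) (n : 𝒥 → Fin m) :
    residualWord label f c.inner.length (labelled 𝒥 n) = (c.quot label 𝒥 n).inner := by
  classical
  obtain ⟨-, -, hd⟩ := mem_labelledExtractions.1 (labelled_mem hf h𝒥 n)
  have hcast {J : Finset c.Pos} {p : c.Pos} :
      (p : ℕ) ∈ J.map Fin.valEmbedding ↔ p ∈ J := by simp [Fin.val_inj]
  rw [quot, sort_map_eq_filterMap, residualWord, ← List.map_coe_finRange_eq_range,
    List.filterMap_map]
  refine List.filterMap_congr fun p _ => ?_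
  simp only [Function.comp_apply, Finset.mem_filter, Finset.mem_univ, true_and]
  split_ifs with h₁ h₂
  · exact residue_of_isLeast hd (mem_labelled.2 ⟨h₂.choose, rfl⟩)
      (isLeast_map_val.2 h₂.choose_spec)
  · rw [← hf]
    refine residue_of_forall_notMem fun P hP => ?_
    obtain ⟨J, rfl⟩ := mem_labelled.1 hP
    exact fun hp => h₂ ⟨J, h₁ J.1 J.2 (hcast.1 hp)⟩
  · push Not at h₁
    obtain ⟨J, hJ, hp, hmin⟩ := h₁
    exact residue_of_not_isLeast (mem_labelled.2 ⟨⟨J, hJ⟩, rfl⟩) (hcast.2 hp)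
      fun h => hmin (isLeast_map_val.1 h)

lemma extractedTree_map_val (hf : ∀ p : c.Pos, f p = c.colour p) (J : Finset c.Pos) (j : Fin m) :
    extractedTree f (J.map Fin.valEmbedding, j) = c.sub J j := by
  have h : (J.map Fin.valEmbedding).sort (· ≤ ·) = (J.sort (· ≤ ·)).map Fin.val :=
    (Finset.map_sort Fin.valEmbedding J (· ≤ ·) (· ≤ ·) fun _ _ _ _ => Iff.rfl).symm
  simp only [extractedTree, sub, h, ← List.map_tail, List.map_map]
  congr 2
  exact funext hf

lemma extractionTerm_labelled (hf : ∀ p : c.Pos, f p = c.colour p) (label : Fin m → β)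
    {𝒥 : Finset (Finset c.Pos)} (h𝒥 : 𝒥 ∈ c.extractions) (n : 𝒥 → Fin m) :
    extractionTerm k label f c.inner.length c.root (labelled 𝒥 n) =
      X (c.quot label 𝒥 n) ⊗ₜ ∏ J : 𝒥, X (c.sub J.1 (n J)) := by
  rw [extractionTerm, residualWord_labelled hf label h𝒥, labelled, Finset.prod_image]
  · simp only [extractedTree_map_val hf]
    rfl
  · intro J _ K _ h
    exact Subtype.ext (Finset.map_injective _ (Prod.mk.inj h).1)

theorem comulTree_eq_sum_extractionTerm (hf : ∀ p : c.Pos, f p = c.colour p)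
    (label : Fin m → β) :
    comulTree k label c = 1 ⊗ₜ X c + ∑ 𝒬 ∈ labelledExtractions m f c.inner.length,
      extractionTerm k label f c.inner.length c.root 𝒬 := by
  rw [comulTree, Finset.sum_sigma']
  congr 1
  refine Finset.sum_bij (fun x _ => labelled x.1 x.2) ?_ ?_ ?_ ?_
  · rintro ⟨𝒥, n⟩ h
    exact labelled_mem hf (Finset.mem_sigma.1 h).1 n
  · rintro ⟨𝒥, n⟩ - ⟨𝒥', n'⟩ - h
    have key (J : Finset c.Pos) (j : Fin m) :
        (∃ h : J ∈ 𝒥, n ⟨J, h⟩ = j) ↔ ∃ h : J ∈ 𝒥', n' ⟨J, h⟩ = j := by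
      rw [← mk_mem_labelled, ← mk_mem_labelled]
      exact iff_of_eq (congrArg (_ ∈ ·) h)
    obtain rfl : 𝒥 = 𝒥' := by
      ext J
      exact ⟨fun hJ => ((key J _).1 ⟨hJ, rfl⟩).1, fun hJ => ((key J _).2 ⟨hJ, rfl⟩).1⟩
    congr 1
    funext J
    obtain ⟨_, h⟩ := (key J.1 (n J)).1 ⟨J.2, rfl⟩
    exact h.symm
  · intro 𝒬 h𝒬
    obtain ⟨𝒥, h𝒥, n, rfl⟩ := exists_labelled_eq hf h𝒬
    exact ⟨⟨𝒥, n⟩, Finset.mem_sigma.2 ⟨h𝒥, Finset.mem_univ _⟩, rfl⟩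
  · rintro ⟨𝒥, n⟩ h
    exact (extractionTerm_labelled hf label (Finset.mem_sigma.1 h).1 n).symm

end transfer

/-! ### The recursion for the coproduct -/

section grow

open Classical in
/-- The labelled extraction `𝒬` with the new position `N` added to the set `P`. If `P` is
`(∅, j)`, this means that `N` starts a new set with root index `j`. -/
noncomputable def grow (N : ℕ) (𝒬 : Finset (Finset ℕ × Fin m)) (P : Finset ℕ × Fin m) :
    Finset (Finset ℕ × Fin m) :=
  insert (insert N P.1, P.2) (𝒬.erase P)

open Classical in
/-- The sets to which the position `N` can be added: those of `𝒬`, and, if `N` is white, the empty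
set with any root index. -/
noncomputable def growthPoints (f : ℕ → CircleVertex β) (N : ℕ)
    (𝒬 : Finset (Finset ℕ × Fin m)) : Finset (Finset ℕ × Fin m) :=
  𝒬 ∪ if f N = .white then Finset.univ.image (Prod.mk ∅) else ∅

variable {f : ℕ → CircleVertex β} {N : ℕ} {𝒬 : Finset (Finset ℕ × Fin m)}
  {P Q : Finset ℕ × Fin m}

lemma mem_grow : Q ∈ grow N 𝒬 P ↔ Q = (insert N P.1, P.2) ∨ Q ≠ P ∧ Q ∈ 𝒬 := by
  simp [grow]

lemma mem_growthPoints : P ∈ growthPoints f N 𝒬 ↔ P ∈ 𝒬 ∨ f N = .white ∧ P.1 = ∅ := by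
  rw [growthPoints, Finset.mem_union]
  split_ifs with h
  · simp [h, Prod.ext_iff, eq_comm]
  · simp [h]

lemma lt_of_mem_growthPoints (h𝒬 : 𝒬 ∈ labelledExtractions m f N) (hP : P ∈ growthPoints f N 𝒬)
    {p : ℕ} (hp : p ∈ P.1) : p < N := by
  rcases mem_growthPoints.1 hP with h | ⟨-, h⟩
  · exact (mem_labelledExtractions.1 h𝒬).1 P h p hp
  · simp [h] at hp

lemma eq_of_mem_growthPoints (h𝒬 : 𝒬 ∈ labelledExtractions m f N) (hP : P ∈ growthPoints f N 𝒬)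
    (hQ : Q ∈ 𝒬) {p : ℕ} (hp : p ∈ P.1) (hq : p ∈ Q.1) : P = Q := by
  rcases mem_growthPoints.1 hP with h | ⟨-, h⟩
  · exact (mem_labelledExtractions.1 h𝒬).2.2 P h Q hQ p hp hq
  · simp [h] at hp

lemma mem_iff_nonempty_of_mem_growthPoints (h𝒬 : 𝒬 ∈ labelledExtractions m f N)
    (hP : P ∈ growthPoints f N 𝒬) : P ∈ 𝒬 ↔ P.1.Nonempty := by
  refine ⟨fun h => ((mem_labelledExtractions.1 h𝒬).2.1 P h).nonempty, fun h => ?_⟩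
  rcases mem_growthPoints.1 hP with h' | ⟨-, h'⟩
  · exact h'
  · exact absurd h' h.ne_empty

lemma isLeast_insert_iff {J : Finset ℕ} (hJ : ∀ p ∈ J, p < N) {p : ℕ} (hp : p < N) :
    IsLeast ((insert N J : Finset ℕ) : Set ℕ) p ↔ IsLeast (J : Set ℕ) p := by
  simp only [IsLeast, lowerBounds, Finset.coe_insert, Set.mem_insert_iff, Set.mem_ofPred_eq,
    Finset.mem_coe, hp.ne, false_or]
  refine and_congr_right fun hpJ => ⟨fun h a ha => h (Or.inr ha), fun h a ha => ?_⟩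
  rcases ha with rfl | ha
  · exact hp.le
  · exact h ha

lemma isWhiteLed_insert_iff {J : Finset ℕ} (hJ : ∀ p ∈ J, p < N) :
    IsWhiteLed f (insert N J) ↔ IsWhiteLed f J ∨ f N = .white ∧ J = ∅ := by
  rcases J.eq_empty_or_nonempty with rfl | hne
  · have : ¬IsWhiteLed f ∅ := fun h => by simpa using h.nonempty
    simp only [this, false_or, and_true]
    refine ⟨fun ⟨p, hp, hw⟩ => ?_, fun hw => ⟨N, by simp, hw⟩⟩
    rwa [← show p = N by simpa using hp.1]
  · simp only [hne.ne_empty, and_false, or_false]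
    constructor
    · rintro ⟨p, hp, hw⟩
      obtain ⟨q, hq⟩ := hne
      have hpN : p < N := (hp.2 (Finset.mem_insert_of_mem hq)).trans_lt (hJ q hq)
      exact ⟨p, (isLeast_insert_iff hJ hpN).1 hp, hw⟩
    · rintro ⟨p, hp, hw⟩
      exact ⟨p, (isLeast_insert_iff hJ (hJ p hp.1)).2 hp, hw⟩

lemma grow_mem (h𝒬 : 𝒬 ∈ labelledExtractions m f N) (hP : P ∈ growthPoints f N 𝒬) :
    grow N 𝒬 P ∈ labelledExtractions m f (N + 1) := by
  have hlt {p : ℕ} (hp : p ∈ P.1) : p < N := lt_of_mem_growthPoints h𝒬 hP hp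
  have heq {Q} (hQ : Q ∈ 𝒬) {p : ℕ} (hp : p ∈ P.1) (hq : p ∈ Q.1) : P = Q :=
    eq_of_mem_growthPoints h𝒬 hP hQ hp hq
  obtain ⟨h₁, h₂, h₃⟩ := mem_labelledExtractions.1 h𝒬
  simp only [mem_labelledExtractions, mem_grow]
  refine ⟨?_, ?_, ?_⟩
  · rintro Q (rfl | ⟨-, hQ⟩) p hp
    · rcases Finset.mem_insert.1 hp with rfl | hp
      · omega
      · exact (hlt hp).trans (Nat.lt_succ_self N)
    · exact (h₁ Q hQ p hp).trans (Nat.lt_succ_self N)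
  · rintro Q (rfl | ⟨-, hQ⟩)
    · refine (isWhiteLed_insert_iff fun p hp => hlt hp).2 ?_
      rcases mem_growthPoints.1 hP with h | h
      · exact .inl (h₂ P h)
      · exact .inr h
    · exact h₂ Q hQ
  · have key (Q) (hne : Q ≠ P) (hQ : Q ∈ 𝒬) (p : ℕ) (hp : p ∈ insert N P.1) : p ∉ Q.1 := by
      intro hq
      rcases Finset.mem_insert.1 hp with rfl | hp
      · exact (h₁ Q hQ _ hq).false
      · exact hne (heq hQ hp hq).symm
    rintro Q (rfl | ⟨hne, hQ⟩) R (rfl | ⟨hne', hR⟩) p hp hq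
    · rfl
    · exact absurd hq (key R hne' hR p hp)
    · exact absurd hp (key Q hne hQ p hq)
    · exact h₃ Q hQ R hR p hp hq

lemma labelledExtractions_eq_filter (f : ℕ → CircleVertex β) (N : ℕ) :
    labelledExtractions m f N =
      (labelledExtractions m f (N + 1)).filter fun 𝒬 => ∀ P ∈ 𝒬, N ∉ P.1 := by
  ext 𝒬
  simp only [Finset.mem_filter, mem_labelledExtractions]
  constructor
  · rintro ⟨h₁, h₂, h₃⟩
    exact ⟨⟨fun P hP p hp => (h₁ P hP p hp).trans (Nat.lt_succ_self N), h₂, h₃⟩,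
      fun P hP hN => (h₁ P hP N hN).false⟩
  · rintro ⟨⟨h₁, h₂, h₃⟩, h₄⟩
    refine ⟨fun P hP p hp => lt_of_le_of_ne (Nat.lt_succ_iff.1 (h₁ P hP p hp)) ?_, h₂, h₃⟩
    rintro rfl
    exact h₄ P hP hp

lemma notMem_of_mem_labelledExtractions (h𝒬 : 𝒬 ∈ labelledExtractions m f N) (hP : P ∈ 𝒬) :
    N ∉ P.1 :=
  fun h => ((mem_labelledExtractions.1 h𝒬).1 P hP N h).false

lemma grow_injective {𝒬' : Finset (Finset ℕ × Fin m)} {P' : Finset ℕ × Fin m}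
    (h𝒬 : 𝒬 ∈ labelledExtractions m f N) (hP : P ∈ growthPoints f N 𝒬)
    (h𝒬' : 𝒬' ∈ labelledExtractions m f N) (hP' : P' ∈ growthPoints f N 𝒬')
    (h : grow N 𝒬 P = grow N 𝒬' P') : 𝒬 = 𝒬' ∧ P = P' := by
  have hN : N ∉ P.1 := fun h => (lt_of_mem_growthPoints h𝒬 hP h).false
  have hN' : N ∉ P'.1 := fun h => (lt_of_mem_growthPoints h𝒬' hP' h).false
  obtain rfl : P = P' := by
    have := h ▸ mem_grow.2 (Or.inl (Eq.refl (insert N P.1, P.2)))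
    rcases mem_grow.1 this with h' | ⟨-, h'⟩
    · obtain ⟨h₁, h₂⟩ := Prod.mk.inj h'
      refine Prod.ext ?_ h₂
      rw [← Finset.erase_insert hN, h₁, Finset.erase_insert hN']
    · exact absurd (Finset.mem_insert_self _ _) (notMem_of_mem_labelledExtractions h𝒬' h')
  refine ⟨?_, rfl⟩
  ext Q
  by_cases hQP : Q = P
  · rw [hQP, mem_iff_nonempty_of_mem_growthPoints h𝒬 hP,
      mem_iff_nonempty_of_mem_growthPoints h𝒬' hP']
  · have hQ := congrArg (Q ∈ ·) h
    simp only [mem_grow, ne_eq, hQP, not_false_iff, true_and, eq_iff_iff] at hQ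
    by_cases hQN : N ∈ Q.1
    · exact iff_of_false (fun h => notMem_of_mem_labelledExtractions h𝒬 h hQN)
        (fun h => notMem_of_mem_labelledExtractions h𝒬' h hQN)
    · have hne : Q ≠ (insert N P.1, P.2) := by
        rintro rfl
        exact hQN (Finset.mem_insert_self _ _)
      simpa [hne] using hQ

lemma exists_grow_eq {𝒬' : Finset (Finset ℕ × Fin m)}
    (h𝒬' : 𝒬' ∈ labelledExtractions m f (N + 1)) {R : Finset ℕ × Fin m} (hR : R ∈ 𝒬')
    (hN : N ∈ R.1) :
    ∃ 𝒬 ∈ labelledExtractions m f N, ∃ P ∈ growthPoints f N 𝒬, grow N 𝒬 P = 𝒬' := by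
  classical
  obtain ⟨h₁, h₂, h₃⟩ := mem_labelledExtractions.1 h𝒬'
  set P : Finset ℕ × Fin m := (R.1.erase N, R.2) with hPdef
  have hRP : (insert N P.1, P.2) = R := Prod.ext (Finset.insert_erase hN) rfl
  have hPlt : ∀ p ∈ P.1, p < N := fun p hp => lt_of_le_of_ne
    (Nat.lt_succ_iff.1 (h₁ R hR p (Finset.mem_of_mem_erase hp))) (Finset.ne_of_mem_erase hp)
  have hP : IsWhiteLed f P.1 ∨ f N = .white ∧ P.1 = ∅ := by
    rw [← isWhiteLed_insert_iff hPlt]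
    rw [show insert N P.1 = R.1 from congrArg Prod.fst hRP]
    exact h₂ R hR
  have hsub : ∀ p ∈ P.1, p ∈ R.1 := fun p hp => Finset.mem_of_mem_erase hp
  have hPR : P ≠ R := fun h => Finset.notMem_erase N R.1 (by rw [← h] at hN; exact hN)
  have hNQ : ∀ Q ∈ 𝒬', Q ≠ R → N ∉ Q.1 := fun Q hQ hne h => hne (h₃ Q hQ R hR N h hN)
  -- An empty `P` is not an extracted set: then `N` has started the set `R` by itself.
  refine ⟨if P.1 = ∅ then 𝒬'.erase R else insert P (𝒬'.erase R), ?_, P, ?_, ?_⟩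
  · have hold : 𝒬'.erase R ∈ labelledExtractions m f N := by
      simp only [mem_labelledExtractions, Finset.mem_erase]
      refine ⟨fun Q hQ p hp => lt_of_le_of_ne (Nat.lt_succ_iff.1 (h₁ Q hQ.2 p hp)) ?_,
        fun Q hQ => h₂ Q hQ.2, fun Q hQ Q' hQ' => h₃ Q hQ.2 Q' hQ'.2⟩
      rintro rfl
      exact hNQ Q hQ.2 hQ.1 hp
    split_ifs with hPe
    · exact hold
    · obtain ⟨g₁, g₂, g₃⟩ := mem_labelledExtractions.1 hold
      have key (Q) (hQ : Q ∈ 𝒬'.erase R) (p : ℕ) (hp : p ∈ P.1) : p ∉ Q.1 := fun hq =>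
        Finset.ne_of_mem_erase hQ (h₃ Q (Finset.mem_of_mem_erase hQ) R hR p hq (hsub p hp))
      simp only [mem_labelledExtractions, Finset.mem_insert]
      refine ⟨?_, ?_, ?_⟩
      · rintro Q (rfl | hQ)
        exacts [hPlt, g₁ Q hQ]
      · rintro Q (rfl | hQ)
        exacts [hP.resolve_right fun h => hPe h.2, g₂ Q hQ]
      · rintro Q (rfl | hQ) Q' (rfl | hQ') p hp hp'
        exacts [rfl, absurd hp' (key Q' hQ' p hp), absurd hp (key Q hQ p hp'),
          g₃ Q hQ Q' hQ' p hp hp']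
  · rw [mem_growthPoints]
    split_ifs with hPe
    · exact .inr (hP.resolve_left fun h => h.nonempty.ne_empty hPe)
    · exact .inl (Finset.mem_insert_self _ _)
  · have hPmem : P ∉ 𝒬' := by
      intro h
      obtain ⟨p, hp⟩ := (h₂ P h).nonempty
      exact hPR (h₃ P h R hR p hp (hsub p hp))
    ext Q
    rw [mem_grow, hRP]
    by_cases hQR : Q = R
    · simp [hQR, hR]
    · by_cases hQP : Q = P
      · simp [hQP, hPR, hPmem]
      · split_ifs <;> simp [hQR, hQP]

/-- A labelled extraction from `N + 1` vertices either ignores the last one or arises from a unique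
labelled extraction from the first `N` vertices by adding the last one. -/
lemma sum_labelledExtractions_succ {M : Type*} [AddCommMonoid M] (f : ℕ → CircleVertex β) (N : ℕ)
    (F : Finset (Finset ℕ × Fin m) → M) :
    ∑ 𝒬 ∈ labelledExtractions m f (N + 1), F 𝒬 =
      ∑ 𝒬 ∈ labelledExtractions m f N, (F 𝒬 + ∑ P ∈ growthPoints f N 𝒬, F (grow N 𝒬 P)) := by
  rw [← Finset.sum_filter_add_sum_filter_not _ fun 𝒬 => ∀ P ∈ 𝒬, N ∉ P.1,
    ← labelledExtractions_eq_filter, Finset.sum_add_distrib, Finset.sum_sigma']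
  congr 1
  symm
  refine Finset.sum_bij (fun x _ => grow N x.1 x.2) ?_ ?_ ?_ fun _ _ => rfl
  · rintro ⟨𝒬, P⟩ h
    obtain ⟨h𝒬, hP⟩ := Finset.mem_sigma.1 h
    refine Finset.mem_filter.2 ⟨grow_mem h𝒬 hP, fun h => ?_⟩
    exact h _ (mem_grow.2 (Or.inl rfl)) (Finset.mem_insert_self _ _)
  · rintro ⟨𝒬, P⟩ h ⟨𝒬', P'⟩ h' heq
    obtain ⟨h𝒬, hP⟩ := Finset.mem_sigma.1 h
    obtain ⟨h𝒬', hP'⟩ := Finset.mem_sigma.1 h'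
    obtain ⟨rfl, rfl⟩ := grow_injective h𝒬 hP h𝒬' hP' heq
    rfl
  · intro 𝒬' h
    obtain ⟨h𝒬', hN⟩ := Finset.mem_filter.1 h
    push Not at hN
    obtain ⟨R, hR, hN⟩ := hN
    obtain ⟨𝒬, h𝒬, P, hP, rfl⟩ := exists_grow_eq h𝒬' hR hN
    exact ⟨⟨𝒬, P⟩, Finset.mem_sigma.2 ⟨h𝒬, hP⟩, rfl⟩

/-! ### The effect of a new vertex on a term of the coproduct -/

variable (label : Fin m → β)

lemma residualWord_succ (𝒬 : Finset (Finset ℕ × Fin m)) :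
    residualWord label f (N + 1) 𝒬 =
      residualWord label f N 𝒬 ++ (residue label f 𝒬 N).toList := by
  rw [residualWord, List.range_succ, List.filterMap_append, residualWord]
  cases h : residue label f 𝒬 N <;> simp [h]

/-- Adding the position `N` does not change what is left at the earlier positions. -/
lemma residue_grow (h𝒬 : 𝒬 ∈ labelledExtractions m f N) (hP : P ∈ growthPoints f N 𝒬) {p : ℕ}
    (hp : p < N) : residue label f (grow N 𝒬 P) p = residue label f 𝒬 p := by
  have hlt : ∀ p ∈ P.1, p < N := fun p hp => lt_of_mem_growthPoints h𝒬 hP hp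
  have hd := (mem_labelledExtractions.1 h𝒬).2.2
  have hd' := (mem_labelledExtractions.1 (grow_mem h𝒬 hP)).2.2
  -- Below `N`, the set of `𝒬` through `p` and the set of `grow N 𝒬 P` through `p` agree.
  by_cases hex : ∃ Q ∈ 𝒬, p ∈ Q.1
  · obtain ⟨Q, hQ, hpQ⟩ := hex
    obtain ⟨Q', hQ', hpQ', hl, h2⟩ : ∃ Q' ∈ grow N 𝒬 P, p ∈ Q'.1 ∧
        (IsLeast (Q'.1 : Set ℕ) p ↔ IsLeast (Q.1 : Set ℕ) p) ∧ Q'.2 = Q.2 := by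
      by_cases hQP : Q = P
      · subst hQP
        exact ⟨_, mem_grow.2 (Or.inl rfl), Finset.mem_insert_of_mem hpQ,
          isLeast_insert_iff hlt hp, rfl⟩
      · exact ⟨Q, mem_grow.2 (Or.inr ⟨hQP, hQ⟩), hpQ, Iff.rfl, rfl⟩
    by_cases hleast : IsLeast (Q.1 : Set ℕ) p
    · rw [residue_of_isLeast hd hQ hleast, residue_of_isLeast hd' hQ' (hl.2 hleast), h2]
    · rw [residue_of_not_isLeast hQ hpQ hleast,
        residue_of_not_isLeast hQ' hpQ' fun h => hleast (hl.1 h)]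
  · push Not at hex
    rw [residue_of_forall_notMem hex, residue_of_forall_notMem]
    intro Q hQ hpQ
    rcases mem_grow.1 hQ with rfl | ⟨-, hQ⟩
    · rcases Finset.mem_insert.1 hpQ with rfl | hpP
      · exact hp.false
      · exact hex P ((mem_iff_nonempty_of_mem_growthPoints h𝒬 hP).2 ⟨p, hpP⟩) hpP
    · exact hex Q hQ hpQ

lemma residualWord_grow (h𝒬 : 𝒬 ∈ labelledExtractions m f N) (hP : P ∈ growthPoints f N 𝒬) :
    residualWord label f N (grow N 𝒬 P) = residualWord label f N 𝒬 :=
  List.filterMap_congr fun _ hp => residue_grow label h𝒬 hP (List.mem_range.1 hp)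

lemma residualWord_succ_of_mem (h𝒬 : 𝒬 ∈ labelledExtractions m f N) :
    residualWord label f (N + 1) 𝒬 = residualWord label f N 𝒬 ++ [f N] := by
  rw [residualWord_succ, residue_of_forall_notMem fun P hP =>
    notMem_of_mem_labelledExtractions h𝒬 hP]
  rfl

lemma residualWord_succ_grow_of_mem (h𝒬 : 𝒬 ∈ labelledExtractions m f N) (hP : P ∈ 𝒬) :
    residualWord label f (N + 1) (grow N 𝒬 P) = residualWord label f N 𝒬 := by
  have hP' : P ∈ growthPoints f N 𝒬 := mem_growthPoints.2 (Or.inl hP)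
  rw [residualWord_succ, residualWord_grow label h𝒬 hP', residue_of_not_isLeast
    (mem_grow.2 (Or.inl rfl)) (Finset.mem_insert_self _ _)]
  · simp
  · intro h
    obtain ⟨p, hp⟩ := (mem_iff_nonempty_of_mem_growthPoints h𝒬 hP').1 hP
    exact (lt_of_mem_growthPoints h𝒬 hP' hp).not_ge (h.2 (Finset.mem_insert_of_mem hp))

lemma residualWord_succ_grow_empty (h𝒬 : 𝒬 ∈ labelledExtractions m f N) (hN : f N = .white)
    (j : Fin m) : residualWord label f (N + 1) (grow N 𝒬 (∅, j)) =
      residualWord label f N 𝒬 ++ [.black (label j)] := by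
  have hP : (∅, j) ∈ growthPoints f N 𝒬 := mem_growthPoints.2 (Or.inr ⟨hN, rfl⟩)
  rw [residualWord_succ, residualWord_grow label h𝒬 hP, residue_of_isLeast
    (mem_labelledExtractions.1 (grow_mem h𝒬 hP)).2.2 (mem_grow.2 (Or.inl rfl)) (by simp)]
  rfl

lemma extractedTree_insert {J : Finset ℕ} (hJ : ∀ p ∈ J, p < N) (hne : J.Nonempty) (j : Fin m) :
    extractedTree f (insert N J, j) = (extractedTree f (J, j)).snoc (f N) := by
  have h : (insert N J).sort (· ≤ ·) = J.sort (· ≤ ·) ++ [N] := by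
    refine List.Perm.eq_of_pairwise' (Finset.pairwise_sort _ _) ?_ ?_
    · rw [List.pairwise_append]
      exact ⟨Finset.pairwise_sort _ _, by simp, by simpa using fun p hp => (hJ p hp).le⟩
    · rw [List.perm_ext_iff_of_nodup (Finset.sort_nodup _ _)]
      · simp [or_comm]
      · rw [List.nodup_append]
        exact ⟨Finset.sort_nodup _ _, by simp, by simpa using fun p hp => (hJ p hp).ne⟩
  have hs : J.sort (· ≤ ·) ≠ [] := by
    rw [← List.length_pos_iff_ne_nil, Finset.length_sort]
    exact hne.card_pos
  simp [extractedTree, snoc, h, List.tail_append_of_ne_nil hs]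

lemma prod_grow (h𝒬 : 𝒬 ∈ labelledExtractions m f N) {M : Type*} [CommMonoid M]
    (g : Finset ℕ × Fin m → M) [DecidableEq (Finset ℕ × Fin m)] :
    ∏ Q ∈ grow N 𝒬 P, g Q = g (insert N P.1, P.2) * ∏ Q ∈ 𝒬.erase P, g Q := by
  rw [← Finset.prod_insert]
  · rw [grow]
    congr!
  · intro h
    exact notMem_of_mem_labelledExtractions h𝒬 (Finset.mem_of_mem_erase h)
      (Finset.mem_insert_self _ _)

lemma extractionTerm_succ (h𝒬 : 𝒬 ∈ labelledExtractions m f N) (i : Fin m) :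
    extractionTerm k label f (N + 1) i 𝒬 =
      append k (f N) (X ⟨i, residualWord label f N 𝒬⟩) ⊗ₜ ∏ P ∈ 𝒬, X (extractedTree f P) := by
  rw [extractionTerm, residualWord_succ_of_mem label h𝒬, append_X]
  rfl

/-- A last vertex which joins an extracted set is absent from the residual word, and the sum over
the sets it can join is the Leibniz rule for the product of the extracted trees. -/
lemma sum_extractionTerm_grow (h𝒬 : 𝒬 ∈ labelledExtractions m f N) (i : Fin m) :
    ∑ P ∈ 𝒬, extractionTerm k label f (N + 1) i (grow N 𝒬 P) =
      X ⟨i, residualWord label f N 𝒬⟩ ⊗ₜ append k (f N) (∏ P ∈ 𝒬, X (extractedTree f P)) := by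
  classical
  rw [Derivation.leibniz_finsetProd, TensorProduct.tmul_sum]
  refine Finset.sum_congr rfl fun P hP => ?_
  obtain ⟨h₁, h₂, -⟩ := mem_labelledExtractions.1 h𝒬
  rw [extractionTerm, residualWord_succ_grow_of_mem label h𝒬 hP, prod_grow h𝒬,
    extractedTree_insert (h₁ P hP) (h₂ P hP).nonempty, append_X, mul_comm]

lemma extractionTerm_grow_empty (h𝒬 : 𝒬 ∈ labelledExtractions m f N) (hN : f N = .white)
    (i j : Fin m) :
    extractionTerm k label f (N + 1) i (grow N 𝒬 (∅, j)) =
      append k (.black (label j)) (X ⟨i, residualWord label f N 𝒬⟩) ⊗ₜ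
        (X (bare β j) * ∏ P ∈ 𝒬, X (extractedTree f P)) := by
  classical
  have he : ((∅, j) : Finset ℕ × Fin m) ∉ 𝒬 := fun h =>
    Finset.not_nonempty_empty ((mem_labelledExtractions.1 h𝒬).2.1 _ h).nonempty
  rw [extractionTerm, residualWord_succ_grow_empty label h𝒬 hN, prod_grow h𝒬, append_X,
    Finset.erase_eq_of_notMem he]
  simp [extractedTree, snoc]

/-- The last vertex can be left alone, added to an extracted set, or, if it is white, start a new
one; these are the summands of `coappend`. -/
lemma extractionTerm_add_sum_grow (h𝒬 : 𝒬 ∈ labelledExtractions m f N) (i : Fin m) :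
    extractionTerm k label f (N + 1) i 𝒬 +
        ∑ P ∈ growthPoints f N 𝒬, extractionTerm k label f (N + 1) i (grow N 𝒬 P) =
      coappend k label (f N) (extractionTerm k label f N i 𝒬) := by
  classical
  rw [growthPoints, Finset.sum_union, sum_extractionTerm_grow label h𝒬,
    extractionTerm_succ label h𝒬, extractionTerm]
  · cases hN : f N with
    | white =>
      rw [if_pos rfl, Finset.sum_image (Prod.mk_right_injective _).injOn, coappend_white_tmul,
        add_assoc]
      simp only [extractionTerm_grow_empty label h𝒬 hN]
    | black b => simp [coappend_black_tmul]
  · refine Finset.disjoint_left.2 fun P hP hP' => ?_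
    split_ifs at hP'
    · obtain ⟨j, -, rfl⟩ := Finset.mem_image.1 hP'
      exact Finset.not_nonempty_empty ((mem_labelledExtractions.1 h𝒬).2.1 _ hP).nonempty
    · simp at hP'

end grow

theorem comulTree_bare (label : Fin m → β) (i : Fin m) :
    comulTree k label (bare β i) = 1 ⊗ₜ X (bare β i) + X (bare β i) ⊗ₜ 1 := by
  have h : labelledExtractions m (fun _ : ℕ => (.white : CircleVertex β)) 0 = {∅} := by
    ext 𝒬
    rw [Finset.mem_singleton, mem_labelledExtractions]
    refine ⟨fun ⟨h₁, h₂, _⟩ => Finset.eq_empty_of_forall_notMem fun P hP => ?_, by rintro rfl; simp⟩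
    obtain ⟨p, hp⟩ := (h₂ P hP).nonempty
    exact absurd (h₁ P hP p hp) p.not_lt_zero
  rw [comulTree_eq_sum_extractionTerm (c := bare β i) (f := fun _ => .white)
    (fun p => absurd p.2 p.1.not_lt_zero)]
  simp [h, extractionTerm, residualWord]

/-- The recursion for the coproduct: appending a vertex to a tree acts through `coappend`. -/
theorem comulTree_snoc (label : Fin m → β) (c : CircleTree m β) (v : CircleVertex β) :
    comulTree k label (c.snoc v) = coappend k label v (comulTree k label c) := by
  -- One colouring serves both trees: `c` consists of the first `c.inner.length` vertices of
  -- `c.snoc v`.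
  set f : ℕ → CircleVertex β := fun p => (c.snoc v).inner.getD p .white with hf
  have hv : f c.inner.length = v := by simp [hf, snoc]
  have hlen : (c.snoc v).inner.length = c.inner.length + 1 := by simp [snoc]
  have h₁ : ∀ p : c.Pos, f p = c.colour p := fun p => by
    simp [hf, snoc, colour, List.getElem?_append]
  have h₂ : ∀ p : (c.snoc v).Pos, f p = (c.snoc v).colour p := fun p => by
    simp [hf, colour]
  rw [comulTree_eq_sum_extractionTerm h₁, comulTree_eq_sum_extractionTerm h₂, hlen,
    sum_labelledExtractions_succ, map_add, map_sum]
  congr 1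
  · cases v <;> simp [coappend_white_tmul, coappend_black_tmul]
  · refine Finset.sum_congr rfl fun 𝒬 h𝒬 => ?_
    rw [← hv]
    exact extractionTerm_add_sum_grow label h𝒬 c.root

@[simp] lemma comul_X (label : Fin m → β) (c : CircleTree m β) :
    comul k label (X c) = comulTree k label c := MvPolynomial.aeval_X _ _

/-- The coproduct intertwines `append k v` with `coappend k label v`. -/
theorem comul_append (label : Fin m → β) (v : CircleVertex β) (x : H) :
    comul k label (append k v x) = coappend k label v (comul k label x) :=
  MvPolynomial.algHom_derivation_apply _ _ _ (fun c => by simp [comulTree_snoc]) x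

@[simp] lemma counit_append (v : CircleVertex β) (x : H) : counit k m β (append k v x) = 0 :=
  MvPolynomial.algHom_derivation_apply (counit k m β) (append k v) 0 (fun c => by simp [counit]) x

/-- An algebra map out of the algebra of trees is determined by its values on the bare trees and by
the effect of appending a vertex. -/
lemma algHom_ext_append {B : Type*} [CommRing B] [Algebra k B] {φ ψ : H →ₐ[k] B}
    (T : CircleVertex β → B → B)
    (hφ : ∀ v x, φ (append k v x) = T v (φ x)) (hψ : ∀ v x, ψ (append k v x) = T v (ψ x))
    (h : ∀ i, φ (X (bare β i)) = ψ (X (bare β i))) : φ = ψ := by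
  refine MvPolynomial.algHom_ext fun c => ?_
  induction c using snoc_induction with
  | bare i => exact h i
  | snoc c v ih => rw [← append_X, hφ, hψ, ih]

/-! ### Coassociativity and counitality -/

variable (k) in
/-- The derivation of the tensor cube through which the iterated coproduct sees `append k v`. -/
noncomputable def coappend₂ (label : Fin m → β) :
    CircleVertex β → Derivation k (H ⊗[k] (H ⊗[k] H)) (H ⊗[k] (H ⊗[k] H)) :=
  appendTensor k label (coappend k label) fun j => comul k label (X (bare β j))

lemma map_id_comul_coappend (label : Fin m → β) (v : CircleVertex β) (x : H ⊗[k] H) :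
    Algebra.TensorProduct.map (.id k H) (comul k label) (coappend k label v x) =
      coappend₂ k label v (Algebra.TensorProduct.map (.id k H) (comul k label) x) := by
  induction x with
  | zero => simp
  | add x y hx hy => simp only [map_add, hx, hy]
  | tmul a b =>
    cases v with
    | white =>
      simp [coappend_white_tmul, coappend₂, comul_append, appendTensor_white_tmul]
    | black c => simp [coappend_black_tmul, coappend₂, comul_append, appendTensor_black_tmul]

/-- The tensor cube, bracketed to the left: the derivation `coappend₂` consists of `coappend` on the
first two factors, `append` on the third, and a new tree in the third factor whose root is left
behind in one of the first two. -/
lemma assoc_coappend_tmul (label : Fin m → β) (v : CircleVertex β) (y : H ⊗[k] H) (b : H) :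
    Algebra.TensorProduct.assoc k k k H H H (coappend k label v y ⊗ₜ b) +
      Algebra.TensorProduct.assoc k k k H H H (y ⊗ₜ append k v b) +
      (match v with
        | .white => ∑ j, Algebra.TensorProduct.assoc k k k H H H
          (coappend k label (.black (label j)) y ⊗ₜ (X (bare β j) * b))
        | .black _ => 0) =
      coappend₂ k label v (Algebra.TensorProduct.assoc k k k H H H (y ⊗ₜ b)) := by
  induction y with
  | zero => cases v <;> simp
  | add y z hy hz =>
    have h : coappend₂ k label v (Algebra.TensorProduct.assoc k k k H H H ((y + z) ⊗ₜ b)) =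
        coappend₂ k label v (Algebra.TensorProduct.assoc k k k H H H (y ⊗ₜ b)) +
          coappend₂ k label v (Algebra.TensorProduct.assoc k k k H H H (z ⊗ₜ b)) := by
      rw [TensorProduct.add_tmul, map_add, map_add]
    rw [h, ← hy, ← hz]
    cases v <;> simp only [map_add, TensorProduct.add_tmul, Finset.sum_add_distrib] <;> abel
  | tmul p q =>
    cases v with
    | white =>
      simp [coappend_white_tmul, coappend_black_tmul, coappend₂, appendTensor_white_tmul,
        TensorProduct.add_tmul, TensorProduct.tmul_add, TensorProduct.sum_tmul,
        TensorProduct.tmul_sum, Finset.sum_add_distrib, add_mul, comulTree_bare]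
      abel
    | black c =>
      simp [coappend_black_tmul, coappend₂, appendTensor_black_tmul, TensorProduct.add_tmul,
        TensorProduct.tmul_add]
      abel

lemma assoc_map_comul_coappend (label : Fin m → β) (v : CircleVertex β) (x : H ⊗[k] H) :
    Algebra.TensorProduct.assoc k k k H H H
        (Algebra.TensorProduct.map (comul k label) (.id k H) (coappend k label v x)) =
      coappend₂ k label v (Algebra.TensorProduct.assoc k k k H H H
        (Algebra.TensorProduct.map (comul k label) (.id k H) x)) := by
  induction x with
  | zero => simp
  | add x y hx hy => simp only [map_add, hx, hy]
  | tmul a b =>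
    rw [Algebra.TensorProduct.map_tmul, AlgHom.id_apply, ← assoc_coappend_tmul]
    cases v with
    | white => simp [coappend_white_tmul, comul_append]
    | black c => simp [coappend_black_tmul, comul_append]

theorem comul_coassoc (label : Fin m → β) :
    (Algebra.TensorProduct.assoc k k k H H H).toAlgHom.comp
        ((Algebra.TensorProduct.map (comul k label) (.id k H)).comp (comul k label)) =
      (Algebra.TensorProduct.map (.id k H) (comul k label)).comp (comul k label) := by
  refine algHom_ext_append (fun v => coappend₂ k label v) (fun v x => ?_) (fun v x => ?_)
    fun i => ?_
  · simp [comul_append, assoc_map_comul_coappend]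
  · simp [comul_append, map_id_comul_coappend]
  · simp [comulTree_bare, TensorProduct.add_tmul, TensorProduct.tmul_add,
      Algebra.TensorProduct.one_def, add_assoc]

theorem counit_comul_left (label : Fin m → β) :
    (Algebra.TensorProduct.map (counit k m β) (.id k H)).comp (comul k label) =
      ((Algebra.TensorProduct.lid k H).symm : H →ₐ[k] k ⊗[k] H) := by
  have key (v : CircleVertex β) (x : H ⊗[k] H) :
      Algebra.TensorProduct.map (counit k m β) (.id k H) (coappend k label v x) =
        (((append k v : Derivation k H H) : H →ₗ[k] H).lTensor k)
          (Algebra.TensorProduct.map (counit k m β) (.id k H) x) := by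
    induction x with
    | zero => simp
    | add x y hx hy => simp only [map_add, hx, hy]
    | tmul a b => cases v <;> simp [coappend_white_tmul, coappend_black_tmul]
  refine algHom_ext_append (fun v => ((append k v : Derivation k H H) : H →ₗ[k] H).lTensor k)
    (fun v x => ?_) (fun v x => ?_) fun i => ?_
  · simp [comul_append, key]
  · simp
  · simp [comulTree_bare, counit]

theorem counit_comul_right (label : Fin m → β) :
    (Algebra.TensorProduct.map (.id k H) (counit k m β)).comp (comul k label) =
      ((Algebra.TensorProduct.rid k k H).symm : H →ₐ[k] H ⊗[k] k) := by
  have key (v : CircleVertex β) (x : H ⊗[k] H) :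
      Algebra.TensorProduct.map (.id k H) (counit k m β) (coappend k label v x) =
        (((append k v : Derivation k H H) : H →ₗ[k] H).rTensor k)
          (Algebra.TensorProduct.map (.id k H) (counit k m β) x) := by
    induction x with
    | zero => simp
    | add x y hx hy => simp only [map_add, hx, hy]
    | tmul a b =>
      have h (j : Fin m) : counit k m β (X (bare β j)) = 0 := by simp [counit]
      cases v <;> simp [coappend_white_tmul, coappend_black_tmul, h]
  refine algHom_ext_append (fun v => ((append k v : Derivation k H H) : H →ₗ[k] H).rTensor k)
    (fun v x => ?_) (fun v x => ?_) fun i => ?_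
  · simp [comul_append, key]
  · simp
  · simp [comulTree_bare, counit]

/-! ### The antipode -/

variable (k) in
/-- The derivation through which the antipode sees `append k v`. The correction for a white vertex
cancels the contribution of the trees which this vertex starts in the coproduct. -/
noncomputable def antiappend (label : Fin m → β) : CircleVertex β → Derivation k H H
  | .white => append k .white - ∑ j, (X (bare β j) : H) • append k (.black (label j))
  | .black b => append k (.black b)

lemma antiappend_white (label : Fin m → β) (x : H) :
    antiappend k label .white x =
      append k .white x - ∑ j, X (bare β j) * append k (.black (label j)) x := by
  simp [antiappend, Derivation.sum_apply]

lemma antiappend_black (label : Fin m → β) (b : β) :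
    antiappend k label (.black b) = append k (.black b) := rfl

variable (k) in
/-- The antipode: `X_i ↦ -X_i` on the bare trees, each further vertex being entered through
`antiappend`. -/
noncomputable def antipode (label : Fin m → β) : H →ₐ[k] H :=
  MvPolynomial.aeval fun c => c.inner.foldl (fun x v => antiappend k label v x) (-X (bare β c.root))

lemma antipode_bare (label : Fin m → β) (i : Fin m) :
    antipode k label (X (bare β i)) = -X (bare β i) := by
  simp [antipode]

theorem antipode_append (label : Fin m → β) (v : CircleVertex β) (x : H) :
    antipode k label (append k v x) = antiappend k label v (antipode k label x) :=
  MvPolynomial.algHom_derivation_apply _ _ _ (fun c => by simp [antipode, snoc]) x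

theorem mul_antipode_left (label : Fin m → β) :
    (Algebra.TensorProduct.lift (antipode k label) (.id k H) fun _ _ => .all _ _).comp
        (comul k label) = (Algebra.ofId k H).comp (counit k m β) := by
  have key (v : CircleVertex β) (x : H ⊗[k] H) :
      Algebra.TensorProduct.lift (antipode k label) (.id k H) (fun _ _ => .all _ _)
        (coappend k label v x) = append k v (Algebra.TensorProduct.lift (antipode k label)
          (.id k H) (fun _ _ => .all _ _) x) := by
    induction x with
    | zero => simp
    | add x y hx hy => simp only [map_add, hx, hy]
    | tmul a b =>
      cases v with
      | white =>
        simp [coappend_white_tmul, antipode_append, antiappend_white, antiappend_black,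
          sub_mul, Finset.sum_mul, mul_assoc, mul_left_comm]
        ring
      | black c =>
        simp [coappend_black_tmul, antipode_append, antiappend]
        ring
  refine algHom_ext_append (fun v => append k v) (fun v x => ?_) (fun v x => ?_) fun i => ?_
  · simp only [AlgHom.comp_apply, comul_append, key]
  · simp [Algebra.ofId_apply]
  · simp [comulTree_bare, antipode_bare, counit]

theorem mul_antipode_right (label : Fin m → β) :
    (Algebra.TensorProduct.lift (.id k H) (antipode k label) fun _ _ => .all _ _).comp
        (comul k label) = (Algebra.ofId k H).comp (counit k m β) := by
  have key (v : CircleVertex β) (x : H ⊗[k] H) :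
      Algebra.TensorProduct.lift (.id k H) (antipode k label) (fun _ _ => .all _ _)
        (coappend k label v x) = antiappend k label v (Algebra.TensorProduct.lift (.id k H)
          (antipode k label) (fun _ _ => .all _ _) x) := by
    induction x with
    | zero => simp
    | add x y hx hy => simp only [map_add, hx, hy]
    | tmul a b =>
      cases v with
      | white =>
        simp [coappend_white_tmul, antipode_append, antiappend_white, antipode_bare, mul_sub,
          Finset.mul_sum]
        simp only [mul_left_comm, mul_comm]
        ring
      | black c =>
        simp [coappend_black_tmul, antipode_append, antiappend]
        ring
  refine algHom_ext_append (fun v => antiappend k label v) (fun v x => ?_) (fun v x => ?_)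
    fun i => ?_
  · simp only [AlgHom.comp_apply, comul_append, key]
  · simp [Algebra.ofId_apply]
  · simp [comulTree_bare, antipode_bare, counit]

/-! ### The grading -/

/-- The degree which a vertex contributes: `2` if it is white, `1` if it is black. -/
def vertexDeg : CircleVertex β → ℕ
  | .white => 2
  | .black _ => 1

lemma deg_snoc (c : CircleTree m β) (v : CircleVertex β) :
    (c.snoc v).deg = c.deg + vertexDeg v := by
  cases v <;> simp [deg, snoc, vertexDeg] <;> ring

lemma one_mem_component : (1 : H) ∈ component k m β 0 :=
  MvPolynomial.isWeightedHomogeneous_one k _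

lemma X_mem_component (c : CircleTree m β) : (X c : H) ∈ component k m β c.deg :=
  MvPolynomial.isWeightedHomogeneous_X k _ c

lemma mul_mem_component {p q : ℕ} {x y : H} (hx : x ∈ component k m β p)
    (hy : y ∈ component k m β q) : x * y ∈ component k m β (p + q) :=
  MvPolynomial.IsWeightedHomogeneous.mul hx hy

/-- A homogeneous polynomial lies in every family of subspaces which contains the monomials, that
is, which contains `1` and is stable under multiplication by a tree. -/
lemma component_induction {P : ℕ → Submodule k H} (one : 1 ∈ P 0)
    (mul_X : ∀ p x c, x ∈ component k m β p → x ∈ P p → x * X c ∈ P (p + c.deg))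
    {d : ℕ} {x : H} (hx : x ∈ component k m β d) : x ∈ P d := by
  have mono (s : CircleTree m β →₀ ℕ) : ∀ a : k,
      MvPolynomial.monomial s a ∈ P (Finsupp.weight deg s) := by
    classical
    obtain ⟨M, rfl⟩ := Multiset.toFinsupp.surjective s
    induction M using Multiset.induction_on with
    | empty =>
      intro a
      simpa [MvPolynomial.smul_eq_C_mul] using (P 0).smul_mem a one
    | cons c M ih =>
      intro a
      rw [← Multiset.singleton_add, map_add, add_comm, Multiset.toFinsupp_singleton, map_add,
        Finsupp.weight_single, one_smul, MvPolynomial.monomial_add_single, pow_one]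
      exact mul_X _ _ c (MvPolynomial.isWeightedHomogeneous_monomial _ _ _ rfl) (ih a)
  rw [← MvPolynomial.support_sum_monomial_coeff x]
  refine Submodule.sum_mem _ fun s hs => ?_
  rw [← hx (MvPolynomial.mem_support_iff.1 hs)]
  exact mono s _

lemma append_mem_component (v : CircleVertex β) {p : ℕ} {x : H} (hx : x ∈ component k m β p) :
    append k v x ∈ component k m β (p + vertexDeg v) := by
  refine component_induction
    (P := fun p => (component k m β (p + vertexDeg v)).comap ((append k v : Derivation k H H) :
      H →ₗ[k] H)) (by simp) (fun p x c hx h => ?_) hx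
  simp only [Submodule.mem_comap, Derivation.coeFn_coe, Derivation.leibniz, smul_eq_mul,
    append_X] at h ⊢
  refine add_mem ?_ ?_
  · rw [add_assoc, ← deg_snoc]
    exact mul_mem_component hx (X_mem_component _)
  · rw [add_comm p, add_assoc]
    exact mul_mem_component (X_mem_component _) h

/-- The component of degree `d` of the tensor square. -/
noncomputable def tensorComponent (k : Type*) [Field k] (m : ℕ) (β : Type) (d : ℕ) :
    Submodule k (MvPolynomial (CircleTree m β) k ⊗[k] MvPolynomial (CircleTree m β) k) :=
  ⨆ (p : ℕ) (q : ℕ) (_ : p + q = d),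
    LinearMap.range (TensorProduct.mapIncl (component k m β p) (component k m β q))

lemma tmul_mem_tensorComponent {p q d : ℕ} (h : p + q = d) {x y : H}
    (hx : x ∈ component k m β p) (hy : y ∈ component k m β q) :
    x ⊗ₜ[k] y ∈ tensorComponent k m β d :=
  Submodule.mem_iSup_of_mem p <| Submodule.mem_iSup_of_mem q <| Submodule.mem_iSup_of_mem h
    ⟨(⟨x, hx⟩ : component k m β p) ⊗ₜ (⟨y, hy⟩ : component k m β q), rfl⟩

lemma tensorComponent_le {d : ℕ} {N : Submodule k (H ⊗[k] H)}
    (h : ∀ p q, p + q = d → ∀ x ∈ component k m β p, ∀ y ∈ component k m β q, x ⊗ₜ[k] y ∈ N) :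
    tensorComponent k m β d ≤ N := by
  refine iSup_le fun p => iSup_le fun q => iSup_le fun hpq => ?_
  rintro _ ⟨t, rfl⟩
  induction t with
  | zero => simp
  | add s t hs ht => rw [map_add]; exact add_mem hs ht
  | tmul x y => exact h p q hpq x x.2 y y.2

lemma mul_mem_tensorComponent {d e : ℕ} {z w : H ⊗[k] H} (hz : z ∈ tensorComponent k m β d)
    (hw : w ∈ tensorComponent k m β e) : z * w ∈ tensorComponent k m β (d + e) := by
  refine (tensorComponent_le (N := (tensorComponent k m β (d + e)).comap
    (LinearMap.mulRight k w)) fun p q h x hx y hy => ?_) hz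
  refine (tensorComponent_le (N := (tensorComponent k m β (d + e)).comap
    (LinearMap.mulLeft k (x ⊗ₜ[k] y))) fun p' q' h' x' hx' y' hy' => ?_) hw
  simp only [Submodule.mem_comap, LinearMap.mulLeft_apply, Algebra.TensorProduct.tmul_mul_tmul]
  exact tmul_mem_tensorComponent (by omega) (mul_mem_component hx hx') (mul_mem_component hy hy')

lemma coappend_mem_tensorComponent (label : Fin m → β) (v : CircleVertex β) {d : ℕ}
    {z : H ⊗[k] H} (hz : z ∈ tensorComponent k m β d) :
    coappend k label v z ∈ tensorComponent k m β (d + vertexDeg v) := by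
  refine (tensorComponent_le (N := (tensorComponent k m β (d + vertexDeg v)).comap
    ((coappend k label v : Derivation k (H ⊗[k] H) (H ⊗[k] H)) : H ⊗[k] H →ₗ[k] H ⊗[k] H))
    fun p q h x hx y hy => ?_) hz
  have h₁ := tmul_mem_tensorComponent (d := d + vertexDeg v) (by omega)
    (append_mem_component v hx) hy
  have h₂ := tmul_mem_tensorComponent (d := d + vertexDeg v) (by omega) hx
    (append_mem_component v hy)
  rw [Submodule.mem_comap, Derivation.coeFn_coe]
  cases v with
  | white =>
    rw [coappend_white_tmul]
    refine add_mem (add_mem h₁ h₂) (sum_mem fun j _ => ?_)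
    -- A white vertex has degree `2`: the black vertex left behind and the new root carry `1` each.
    exact tmul_mem_tensorComponent (by simp [vertexDeg, deg]; omega)
      (append_mem_component _ hx) (mul_mem_component (X_mem_component _) hy)
  | black c =>
    rw [coappend_black_tmul]
    exact add_mem h₁ h₂

lemma comulTree_mem_tensorComponent (label : Fin m → β) (c : CircleTree m β) :
    comulTree k label c ∈ tensorComponent k m β c.deg := by
  induction c using snoc_induction with
  | bare i =>
    rw [comulTree_bare]
    exact add_mem (tmul_mem_tensorComponent (zero_add _) one_mem_component (X_mem_component _))
      (tmul_mem_tensorComponent (add_zero _) (X_mem_component _) one_mem_component)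
  | snoc c v ih =>
    rw [comulTree_snoc, deg_snoc]
    exact coappend_mem_tensorComponent label v ih

theorem comul_mem_tensorComponent (label : Fin m → β) {d : ℕ} {x : H}
    (hx : x ∈ component k m β d) : comul k label x ∈ tensorComponent k m β d := by
  refine component_induction
    (P := fun d => (tensorComponent k m β d).comap (comul k label).toLinearMap) ?_
    (fun p x c _ h => ?_) hx
  · simpa [Algebra.TensorProduct.one_def] using
      tmul_mem_tensorComponent (zero_add _) one_mem_component one_mem_component
  · simp only [Submodule.mem_comap, AlgHom.toLinearMap_apply, map_mul, comul_X] at h ⊢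
    exact mul_mem_tensorComponent h (comulTree_mem_tensorComponent label c)

theorem component_zero : component k m β 0 = Submodule.span k {1} := by
  refine le_antisymm (fun x hx => ?_) ?_
  · refine component_induction (P := fun d => if d = 0 then Submodule.span k {1} else ⊤)
      (by simp [Submodule.mem_span_singleton_self]) (fun p x c _ _ => ?_) hx
    -- Every tree has positive degree, so only the monomial `1` has degree `0`.
    simp [deg]
  · rw [Submodule.span_singleton_le_iff_mem]
    exact one_mem_component

/-- The Hopf algebra of rooted circle trees, whatever the labels of the black vertices. -/
theorem isConnectedGradedHopfAlgebra (k : Type*) [Field k] (label : Fin m → β) :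
    IsConnectedGradedHopfAlgebra (A := MvPolynomial (CircleTree m β) k) (comul k label)
      (counit k m β) (component k m β) where
  hopf :=
     exists_hopfAlgebra_eq_ofAlgHom (comul_coassoc label) (counit_comul_left label)
      (counit_comul_right label) (antipode k label) (mul_antipode_left label)
      (mul_antipode_right label)
  graded := ⟨MvPolynomial.weightedGradedAlgebra k deg⟩
  comul_mem _ _ hx := comul_mem_tensorComponent label hx
  connected := component_zero

end CircleTree

theorem mainTheorem1 (k : Type*) [Field k] [CharZero k] (m : ℕ) :
    IsConnectedGradedHopfAlgebra
        (A := MvPolynomial (BicoloredCircleTree m) k)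
        (CircleTree.comul k fun _ => ())
        (CircleTree.counit k m Unit)
        (CircleTree.component k m Unit) ∧
      IsConnectedGradedHopfAlgebra
        (A := MvPolynomial (DecoratedCircleTree m) k)
        (CircleTree.comul k id)
        (CircleTree.counit k m (Fin m))
        (CircleTree.component k m (Fin m)) := by
  exact ⟨CircleTree.isConnectedGradedHopfAlgebra k _, CircleTree.isConnectedGradedHopfAlgebra k _⟩
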